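/- Let $\mu$ be the (completed) product measure on the Cantor space $2^\omega$, where each factor $\{0,1\}$ carries the uniform probability measure. An ideal on $\omega$ is a family $J\subseteq\mathcal P(\omega)$ that is closed under subsets and finite unions, contains all finite subsets of $\omega$, and satisfies $\omega\notin J$. It has the Baire property if it has the Baire property as a subset of $\mathcal P(\omega)\cong 2^\omega$ (identifying sets with their characteristic functions). Let $\mathcal N$ be the family of $\mu$-null subsets of $2^\omega$ and let $\mathcal E$ be the $\sigma$-ideal generated by the closed $\mu$-null subsets of $2^\omega$ (equivalently, by the $F_\sigma$ $\mu$-null subsets). Let $\overline\Omega$ be the set of all sequences $\bar c=\langle c_n : n<\omega\rangle$ of clopen subsets of $2^\omega$ such that $\mu\left(\{x : x\in c_n \text{ for infinitely many } n\}\right)=0$. For an ideal $J$ on $\omega$ put \[ \mathcal N_J=\{X\subseteq 2^\omega : (\exists \bar c\in\overline\Omega)(\forall x\in X)\ \{n<\omega : x\in c_n\}\notin J\}, \] \[ \mathcal N^*_J=\{X\subseteq 2^\omega : (\exists \bar c\in\overline\Omega)(\forall x\in X)\ \{n<\omega : x\notin c_n\}\in J\}. \] Theorem. For every ideal $J$ on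 $\omega$, the following three statements are equivalent: (i) $J$ has the Baire property; (ii) $\mathcal N_J=\mathcal N$; (iii) $\mathcal N^*_J=\mathcal E$. -/

import Mathlib

open MeasureTheory

namespace NullModulo

/-- The Cantor space `2^ω`, with its product topology and product (= Borel) σ-algebra. -/
abbrev Cantor : Type := ℕ → Bool

/-- Lebesgue measure on the Cantor space: the product of the uniform probability measures on
`{0, 1}`. A Mathlib measure is defined on all subsets, as an outer measure, so the sets of value `0`
are precisely the null sets of the completion. -/
noncomputable def cantorMeasure : Measure Cantor :=
  Measure.infinitePi fun _ : ℕ => (PMF.uniformOfFintype Bool).toMeasure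

/-- Ideals on a set `M`: hereditary families of subsets of `M`, closed under finite unions,
containing all finite subsets of `M`, and not containing `M` itself. -/
structure IsIdealOn {M : Type*} (J : Set (Set M)) : Prop where
  subset_mem : ∀ a b : Set M, a ⊆ b → b ∈ J → a ∈ J
  union_mem : ∀ a b : Set M, a ∈ J → b ∈ J → a ∪ b ∈ J
  finite_mem : ∀ a : Set M, a.Finite → a ∈ J
  univ_notMem : Set.univ ∉ J

/-- A family of subsets of `ω` has the Baire property if it does so as a subset of the Cantor space,
subsets of `ω` being identified with their characteristic functions. (The type `Set ℕ` itself is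
not used as a space here, since `Prop` carries the Sierpiński topology.) -/
def HasBaireProperty (J : Set (Set ℕ)) : Prop :=
  BaireMeasurableSet {x : Cantor | {n : ℕ | x n = true} ∈ J}

/-- The ideal of null subsets of the Cantor space. -/
def nullIdeal : Set (Set Cantor) := {X | cantorMeasure X = 0}

/-- The σ-ideal generated by the closed null subsets of the Cantor space (equivalently, by the
`F_σ` null subsets). -/
def closedNullIdeal : Set (Set Cantor) :=
  {X | ∃ F : ℕ → Set Cantor,
    (∀ n, IsClosed (F n) ∧ cantorMeasure (F n) = 0) ∧ X ⊆ ⋃ n, F n}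

/-- `N(c)`: the points that belong to infinitely many of the sets `c n`. -/
def limsupSet (c : ℕ → Set Cantor) : Set Cantor := {x | {n | x ∈ c n}.Infinite}

/-- The sequences `c` of clopen sets for which `N(c)` is null. -/
def clopenNullSeq : Set (ℕ → Set Cantor) :=
  {c | (∀ n, IsClopen (c n)) ∧ limsupSet c ∈ nullIdeal}

/-- `N_J(c)`: the points `x` for which `{n | x ∈ c n}` is not in `J`. -/
def limsupSetMod (J : Set (Set ℕ)) (c : ℕ → Set Cantor) : Set Cantor :=
  {x | {n | x ∈ c n} ∉ J}

/-- `N*_J(c)`: the points `x` for which `{n | x ∈ c n}` is in the filter dual to `J`. -/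
def liminfSetMod (J : Set (Set ℕ)) (c : ℕ → Set Cantor) : Set Cantor :=
  {x | {n | x ∈ c n}ᶜ ∈ J}

/-- `𝒩_J`: the sets that are null modulo `J`. -/
def nullMod (J : Set (Set ℕ)) : Set (Set Cantor) :=
  {X | ∃ c ∈ clopenNullSeq, X ⊆ limsupSetMod J c}

/-- `𝒩*_J`. -/
def nullStarMod (J : Set (Set ℕ)) : Set (Set Cantor) :=
  {X | ∃ c ∈ clopenNullSeq, X ⊆ liminfSetMod J c}

end NullModulo

open MeasureTheory Set
open scoped ENNReal

namespace NullModulo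

/-! All three statements amount to `HasSeparatingBlocks J`, the Talagrand–Jalali-Naini criterion for
the Baire property. With such blocks, repeating `c j` throughout block `j` turns "infinitely often"
into "not in `J`", and uniting the `c k` over each block turns `J`-almost everywhere membership into
membership in an `F_σ` null set.

Without such blocks, the single sequence `zeroBlock` refutes both equalities: `liminfSetMod J
zeroBlock` is not even meager (`liminfSetMod_zeroBlock_notMem`), and a fusion argument
(`limsupSet_zeroBlock_not_subset`) shows that the null set `limsupSet zeroBlock` is not in `nullMod
J`. -/

/-! ### Cylinders and clopen sets -/

theorem exists_cylinder_subset {U : Set Cantor} (hU : IsOpen U) {x : Cantor} (hx : x ∈ U) :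
    ∃ m, ∀ y : Cantor, (∀ i < m, y i = x i) → y ∈ U := by
  obtain ⟨_, ⟨w, m, rfl⟩, hxw, hwU⟩ :=
    (PiNat.isTopologicalBasis_cylinders (fun _ : ℕ => Bool)).exists_subset_of_mem_open hx hU
  exact ⟨m, fun y hy => hwU fun i hi => (hy i hi).trans (hxw i hi)⟩

/-- The union of the cylinders of length `m` contained in `U`. -/
def innerClopen (U : Set Cantor) (m : ℕ) : Set Cantor :=
  {x | ∀ y : Cantor, (∀ i < m, y i = x i) → y ∈ U}

theorem isOpen_of_cylinder {A : Set Cantor} {m : ℕ}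
    (h : ∀ x ∈ A, ∀ y : Cantor, (∀ i < m, y i = x i) → y ∈ A) : IsOpen A := by
  rw [isOpen_iff_mem_nhds]
  intro x hx
  exact Filter.mem_of_superset
    ((PiNat.isOpen_cylinder (fun _ : ℕ => Bool) x m).mem_nhds (PiNat.self_mem_cylinder x m))
    fun y hy => h x hx y hy

theorem isClopen_of_cylinder {A : Set Cantor} {m : ℕ}
    (h : ∀ x ∈ A, ∀ y : Cantor, (∀ i < m, y i = x i) → y ∈ A) : IsClopen A := by
  refine ⟨⟨isOpen_of_cylinder (m := m) fun x hx y hy hyA => hx ?_⟩, isOpen_of_cylinder h⟩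
  exact h y hyA x fun i hi => (hy i hi).symm

theorem isClopen_innerClopen (U : Set Cantor) (m : ℕ) : IsClopen (innerClopen U m) :=
  isClopen_of_cylinder (m := m) fun _ hx _ hy z hz => hx z fun i hi => (hz i hi).trans (hy i hi)

theorem innerClopen_subset (U : Set Cantor) (m : ℕ) : innerClopen U m ⊆ U :=
  fun x hx => hx x fun _ _ => rfl

theorem monotone_innerClopen (U : Set Cantor) : Monotone (innerClopen U) :=
  fun _ _ hmn _ hx y hy => hx y fun i hi => hy i (hi.trans_le hmn)

theorem iUnion_innerClopen {U : Set Cantor} (hU : IsOpen U) : ⋃ m, innerClopen U m = U := by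
  refine (iUnion_subset fun m => innerClopen_subset U m).antisymm fun x hx => ?_
  obtain ⟨m, hm⟩ := exists_cylinder_subset hU hx
  exact mem_iUnion.2 ⟨m, hm⟩

theorem exists_cylinder_of_isClopen {c : Set Cantor} (hc : IsClopen c) :
    ∃ m, ∀ x y : Cantor, (∀ i < m, y i = x i) → (x ∈ c ↔ y ∈ c) := by
  obtain ⟨m, hm⟩ := hc.1.isCompact.elim_directed_cover (innerClopen c)
    (fun m => (isClopen_innerClopen c m).2) (iUnion_innerClopen hc.2).ge
    (monotone_innerClopen c).directed_le
  exact ⟨m, fun x y hxy => ⟨fun hx => hm hx y hxy,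
    fun hy => hm hy x fun i hi => (hxy i hi).symm⟩⟩

/-! ### The product measure -/

instance : IsProbabilityMeasure cantorMeasure := by
  unfold cantorMeasure; infer_instance

theorem uniformBool_singleton (b : Bool) :
    (PMF.uniformOfFintype Bool).toMeasure {b} = 2⁻¹ := by
  rw [PMF.toMeasure_apply_singleton _ _ (measurableSet_singleton b)]
  simp

theorem cantorMeasure_cylinder (s : Finset ℕ) (x : Cantor) :
    cantorMeasure {y | ∀ i ∈ s, y i = x i} = 2⁻¹ ^ s.card := by
  have h : {y : Cantor | ∀ i ∈ s, y i = x i} = Set.pi (s : Set ℕ) fun i => {x i} := by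
    ext y; simp [Set.mem_pi]
  rw [h, cantorMeasure, Measure.infinitePi_pi _ fun i _ => measurableSet_singleton _]
  simp only [uniformBool_singleton, Finset.prod_const]

instance : cantorMeasure.IsOpenPosMeasure := by
  refine ⟨fun U hU hne h0 => ?_⟩
  obtain ⟨x, hx⟩ := hne
  obtain ⟨m, hm⟩ := exists_cylinder_subset hU hx
  have h1 : cantorMeasure {y | ∀ i ∈ Finset.range m, y i = x i} = 0 :=
    measure_mono_null (fun y hy => hm y fun i hi => hy i (Finset.mem_range.2 hi)) h0
  rw [cantorMeasure_cylinder] at h1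
  simp at h1

theorem limsupSet_mem_nullIdeal {c : ℕ → Set Cantor} (h : ∑' n, cantorMeasure (c n) ≠ ∞) :
    limsupSet c ∈ nullIdeal := by
  have := measure_limsup_cofinite_eq_zero (μ := cantorMeasure) h
  rwa [Filter.cofinite.limsup_set_eq] at this

theorem compl_limsupSet_dense {c : ℕ → Set Cantor} (h : limsupSet c ∈ nullIdeal) :
    Dense (limsupSet c)ᶜ :=
  interior_eq_empty_iff_dense_compl.1 (Measure.interior_eq_empty_of_null h)

/-- There are only finitely many words of length `l`, so a maximum of pointwise bounds is uniform.
-/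
theorem exists_bound_of_cylinder {P : ℕ → Cantor → Prop} (l : ℕ)
    (hmono : ∀ m n x, m ≤ n → P m x → P n x)
    (hcongr : ∀ n x y, (∀ i < l, y i = x i) → P n x → P n y) (h : ∀ x, ∃ n, P n x) :
    ∃ n, ∀ x, P n x := by
  let e : (Fin l → Bool) → Cantor := fun u i => if hi : i < l then u ⟨i, hi⟩ else false
  choose m hm using fun u => h (e u)
  refine ⟨Finset.univ.sup m, fun x => ?_⟩
  refine hcongr _ (e fun i => x i) x ?_
    (hmono _ _ _ (Finset.le_sup (Finset.mem_univ _)) (hm fun i => x i))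
  intro i hi
  simp [e, hi]

/-! ### Meager sets and interval partitions -/

/-- A word that forces membership in a dense open set, whichever word of length `l` it is
appended to. -/
theorem exists_forcing_block {U : Set Cantor} (hU : IsOpen U) (hd : Dense U) (l : ℕ) :
    ∃ (m : ℕ) (z : Cantor), ∀ x : Cantor, (∀ i, l ≤ i → i < m → x i = z i) → x ∈ U := by
  have key : ∀ S : Finset (Fin l → Bool), ∃ (m : ℕ) (z : Cantor), ∀ x : Cantor,
      (fun i : Fin l => x i) ∈ S → (∀ i, l ≤ i → i < m → x i = z i) → x ∈ U := by
    intro S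
    induction S using Finset.induction_on with
    | empty => exact ⟨0, fun _ => false, fun x hx => by simp at hx⟩
    | insert u S _ ih =>
      obtain ⟨m, z, hz⟩ := ih
      let w : Cantor := fun i => if hi : i < l then u ⟨i, hi⟩ else z i
      obtain ⟨y, hyw, hyU⟩ := hd.inter_open_nonempty _
        (PiNat.isOpen_cylinder (fun _ : ℕ => Bool) w (max l m))
        ⟨w, PiNat.self_mem_cylinder w _⟩
      obtain ⟨k, hk⟩ := exists_cylinder_subset hU hyU
      refine ⟨max m k, y, fun x hx hxy => ?_⟩
      rcases Finset.mem_insert.1 hx with hx | hx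
      · refine hk x fun i hi => ?_
        rcases lt_or_ge i l with hil | hil
        · have h1 : y i = w i := hyw i (lt_max_of_lt_left hil)
          have h2 : x i = u ⟨i, hil⟩ := congrFun hx ⟨i, hil⟩
          rw [h1, h2]
          simp [w, hil]
        · exact hxy i hil (lt_max_of_lt_right hi)
      · refine hz x hx fun i hil him => ?_
        have h1 : y i = w i := hyw i (lt_max_of_lt_right him)
        rw [hxy i hil (lt_max_of_lt_left him), h1]
        simp [w, hil.not_gt]
  obtain ⟨m, z, h⟩ := key Finset.univ
  exact ⟨m, z, fun x hx => h x (Finset.mem_univ _) hx⟩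

theorem exists_blockIndex {a : ℕ → ℕ} (ha : StrictMono a) :
    ∃ r : ℕ → ℕ, (∀ j i, a j ≤ i → i < a (j + 1) → r i = j) ∧ ∀ j i, a j ≤ i → j ≤ r i := by
  refine ⟨fun i => Nat.findGreatest (fun j => a j ≤ i) i, fun j i h1 h2 => ?_, fun j i h =>
    Nat.le_findGreatest ((ha.id_le j).trans h) h⟩
  rw [Nat.findGreatest_eq_iff]
  refine ⟨(ha.id_le j).trans h1, fun _ => h1, fun n hn _ h => ?_⟩
  exact absurd (h2.trans_le (ha.monotone hn)) h.not_gt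

/-- A meager set omits every point that agrees on infinitely many blocks with a suitable point. -/
theorem exists_blocks_of_isMeagre {A : Set Cantor} (hA : IsMeagre A) {p : ℕ → ℕ}
    (hp : StrictMono p) :
    ∃ (b : ℕ → ℕ) (z : Cantor), StrictMono b ∧ ∀ x : Cantor,
      {j | ∀ i, p (b j) ≤ i → i < p (b (j + 1)) → x i = z i}.Infinite → x ∉ A := by
  obtain ⟨S, hSo, hSd, hSc, hSA⟩ := mem_residual_iff.1 hA
  -- Inserting `univ` makes the family nonempty, hence enumerable.
  obtain ⟨f, hf⟩ := (hSc.insert univ).exists_eq_range (insert_nonempty _ _)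
  have hfmem : ∀ n, IsOpen (f n) ∧ Dense (f n) := by
    intro n
    rcases (hf ▸ mem_range_self n : f n ∈ insert univ S) with h | h
    · rw [h]; exact ⟨isOpen_univ, dense_univ⟩
    · exact ⟨hSo _ h, hSd _ h⟩
  have hg : ∀ n, ∃ U : Set Cantor, IsOpen U ∧ Dense U ∧ ∀ k ≤ n, U ⊆ f k := by
    intro n
    induction n with
    | zero => exact ⟨f 0, (hfmem 0).1, (hfmem 0).2, fun k hk => by
        rw [Nat.le_zero.1 hk]⟩
    | succ n ih =>
      obtain ⟨U, hUo, hUd, hU⟩ := ih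
      refine ⟨U ∩ f (n + 1), hUo.inter (hfmem _).1,
        hUd.inter_of_isOpen_left (hfmem _).2 hUo, fun k hk => ?_⟩
      rcases Nat.le_succ_iff.1 hk with h | h
      · exact inter_subset_left.trans (hU k h)
      · rw [h]; exact inter_subset_right
  choose U hUo hUd hU using hg
  choose m z hz using fun n l => exists_forcing_block (hUo n) (hUd n) l
  -- Block `j` is long enough to hold a word forcing entry into `U j` after any prefix of length `p
  -- (b j)`.
  let b : ℕ → ℕ := fun n => Nat.rec 0 (fun j r => max (r + 1) (m j (p r))) n
  have hb : ∀ j, b (j + 1) = max (b j + 1) (m j (p (b j))) := fun j => rfl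
  have hbm : StrictMono b := strictMono_nat_of_lt_succ fun j => by
    rw [hb]; exact lt_max_of_lt_left (Nat.lt_succ_self _)
  obtain ⟨r, hr, -⟩ := exists_blockIndex (hp.comp hbm)
  refine ⟨b, fun i => z (r i) (p (b (r i))) i, hbm, fun x hx hxA => hSA ?_ hxA⟩
  intro t ht
  obtain ⟨k, rfl⟩ : t ∈ range f := hf ▸ mem_insert_of_mem _ ht
  obtain ⟨j, hj, hkj⟩ := hx.exists_gt k
  refine hU j k hkj.le (hz j (p (b j)) x fun i h1 h2 => ?_)
  have h3 : i < p (b (j + 1)) := by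
    refine h2.trans_le (le_trans ?_ (hp.id_le _))
    rw [hb]; exact le_max_right _ _
  rw [hj i h1 h3]
  simp only [hr j i h1 h3]

/-! ### The Baire property and separating blocks -/

/-- No member of `J` includes infinitely many blocks of some partition of `ℕ` into intervals. -/
def HasSeparatingBlocks (J : Set (Set ℕ)) : Prop :=
  ∃ a : ℕ → ℕ, StrictMono a ∧ ∀ s ∈ J, {j | Ico (a j) (a (j + 1)) ⊆ s}.Finite

/-- `J` lies in the union of the closed sets `K k`, which have empty interior because changing a
tail to `true` leaves `K k`. -/
theorem HasSeparatingBlocks.hasBaireProperty {J : Set (Set ℕ)} (h : HasSeparatingBlocks J) :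
    HasBaireProperty J := by
  obtain ⟨a, ha, hJ⟩ := h
  refine IsMeagre.baireMeasurableSet ?_
  let K : ℕ → Set Cantor := fun k => {x | ∀ j, k ≤ j → ∃ i ∈ Ico (a j) (a (j + 1)), x i = false}
  have hK : IsMeagre (⋃ k, K k) := by
    refine isMeagre_iUnion fun k => IsNowhereDense.isMeagre ?_
    have hcl : IsClosed (K k) := by
      refine ⟨isOpen_iff_mem_nhds.2 fun x hx => ?_⟩
      simp only [K, mem_compl_iff, mem_ofPred_eq, not_forall, not_exists, not_and] at hx
      obtain ⟨j, hj, hx⟩ := hx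
      refine Filter.mem_of_superset
        ((PiNat.isOpen_cylinder (fun _ : ℕ => Bool) x (a (j + 1))).mem_nhds
          (PiNat.self_mem_cylinder x _)) fun y hy hyK => ?_
      obtain ⟨i, hi, hyi⟩ := hyK j hj
      exact hx i hi ((hy i hi.2).symm.trans hyi)
    rw [hcl.isNowhereDense_iff, eq_empty_iff_forall_notMem]
    intro x hx
    obtain ⟨m, hm⟩ := exists_cylinder_subset isOpen_interior hx
    have h1 := interior_subset (hm (fun i => if i < m then x i else true) fun i hi => by simp [hi])
    obtain ⟨i, hi, h2⟩ := h1 (max k m) (le_max_left _ _)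
    have h3 : ¬ i < m := not_lt.2 ((le_max_right k m).trans ((ha.id_le _).trans hi.1))
    simp [h3] at h2
  refine hK.mono fun x hx => ?_
  obtain ⟨k, hk⟩ := (hJ _ hx).bddAbove
  refine mem_iUnion.2 ⟨k + 1, fun j hj => ?_⟩
  by_contra hcon
  push Not at hcon
  have : j ≤ k := hk (show Ico (a j) (a (j + 1)) ⊆ {n | x n = true} from fun i hi => by
    simpa using hcon i hi)
  omega

theorem continuous_flipFrom (m : ℕ) :
    Continuous fun (x : Cantor) (i : ℕ) => if i < m then x i else !x i := by
  refine continuous_pi fun i => ?_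
  have h : Continuous fun b : Bool => if i < m then b else !b := continuous_of_discreteTopology
  exact h.comp (continuous_apply (A := fun _ : ℕ => Bool) i)

/-- The homeomorphism of the Cantor space that negates all coordinates from `m` on. -/
def flipFrom (m : ℕ) : Cantor ≃ₜ Cantor where
  toFun x i := if i < m then x i else !x i
  invFun x i := if i < m then x i else !x i
  left_inv x := by ext i; by_cases h : i < m <;> simp [h]
  right_inv x := by ext i; by_cases h : i < m <;> simp [h]
  continuous_toFun := continuous_flipFrom m
  continuous_invFun := continuous_flipFrom m

/-- If `J` were comeager in a cylinder, flipping a tail would give two members of `J` that together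
cover all but finitely much of `ℕ`. -/
theorem IsIdealOn.isMeagre_of_hasBaireProperty {J : Set (Set ℕ)} (hJ : IsIdealOn J)
    (h : HasBaireProperty J) : IsMeagre {x : Cantor | {n : ℕ | x n = true} ∈ J} := by
  obtain ⟨U, hU, hJU⟩ := BaireMeasurableSet.residualEq_isOpen h
  rw [Filter.eventuallyEq_set] at hJU
  rcases U.eq_empty_or_nonempty with rfl | ⟨x, hx⟩
  · filter_upwards [hJU] with y hy
    simpa using hy
  exfalso
  obtain ⟨m, hm⟩ := exists_cylinder_subset hU hx
  have hflip := (tendsto_residual_of_isOpenMap (flipFrom m).continuous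
    (flipFrom m).isOpenMap).eventually hJU
  obtain ⟨y, hyx, hy1, hy2⟩ := (dense_of_mem_residual (hJU.and hflip)).inter_open_nonempty _
    (PiNat.isOpen_cylinder (fun _ : ℕ => Bool) x m) ⟨x, PiNat.self_mem_cylinder x m⟩
  have e1 : {n | y n = true} ∈ J := hy1.2 (hm y hyx)
  have e2 : {n | flipFrom m y n = true} ∈ J := hy2.2 (hm _ fun i hi => by
    simpa [flipFrom, hi] using hyx i hi)
  refine hJ.univ_notMem (hJ.subset_mem _ _ (fun n _ => ?_)
    (hJ.union_mem _ _ (hJ.union_mem _ _ e1 e2) (hJ.finite_mem _ (finite_lt_nat m))))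
  by_cases hn : n < m
  · exact Or.inr hn
  · refine Or.inl ?_
    cases hyn : y n
    · exact Or.inr (by simp [flipFrom, hn, hyn])
    · exact Or.inl hyn

theorem IsIdealOn.hasSeparatingBlocks {J : Set (Set ℕ)} (hJ : IsIdealOn J)
    (h : HasBaireProperty J) : HasSeparatingBlocks J := by
  classical
  obtain ⟨b, z, hb, hz⟩ :=
    exists_blocks_of_isMeagre (hJ.isMeagre_of_hasBaireProperty h) strictMono_id
  refine ⟨b, hb, fun s hs => ?_⟩
  by_contra hinf
  refine hz (fun i => if i ∈ s then z i else false) (Infinite.mono ?_ hinf)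
    (hJ.subset_mem _ s ?_ hs)
  · intro j hj i h1 h2
    simp [hj ⟨h1, h2⟩]
  · intro i hi
    by_contra his
    simp [his] at hi

/-! ### Clopen covers of null sets -/

theorem exists_clopen_superset {F : Set Cantor} (hF : IsClosed F) (h0 : cantorMeasure F = 0)
    {ε : ℝ≥0∞} (hε : 0 < ε) : ∃ c, IsClopen c ∧ F ⊆ c ∧ cantorMeasure c < ε := by
  have hanti : Antitone fun m => (innerClopen Fᶜ m)ᶜ := fun m n h =>
    compl_subset_compl.2 (monotone_innerClopen _ h)
  have hlim := tendsto_measure_iInter_atTop (μ := cantorMeasure)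
    (fun m => (isClopen_innerClopen Fᶜ m).compl.isOpen.measurableSet.nullMeasurableSet) hanti
    ⟨0, measure_ne_top _ _⟩
  rw [← compl_iUnion, iUnion_innerClopen hF.isOpen_compl, compl_compl, h0] at hlim
  obtain ⟨m, hm⟩ := (hlim.eventually (gt_mem_nhds hε)).exists
  exact ⟨_, (isClopen_innerClopen Fᶜ m).compl,
    subset_compl_comm.1 (innerClopen_subset _ _), hm⟩

theorem exists_clopen_cover {X : Set Cantor} (hX : cantorMeasure X = 0) {ε : ℝ≥0∞} (hε : 0 < ε) :
    ∃ c : ℕ → Set Cantor, (∀ n, IsClopen (c n)) ∧ X ⊆ ⋃ n, c n ∧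
      ∑' n, cantorMeasure (c n) ≤ ε := by
  obtain ⟨U, hXU, hU, hUε⟩ := X.exists_isOpen_lt_of_lt ε (hX.symm ▸ hε)
  have hclopen : ∀ n, IsClopen (disjointed (innerClopen U) n) := fun n =>
    disjointedRec (fun _ _ ht => ht.diff (isClopen_innerClopen U _)) (isClopen_innerClopen U n)
  have hunion : ⋃ n, disjointed (innerClopen U) n = U := by
    rw [iUnion_disjointed, iUnion_innerClopen hU]
  refine ⟨disjointed (innerClopen U), hclopen, hunion.symm ▸ hXU, ?_⟩
  rw [← measure_iUnion (disjoint_disjointed _) fun n => (hclopen n).isOpen.measurableSet, hunion]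
  exact hUε.le

theorem tsum_inv_two_pow_ne_top : ∑' n : ℕ, (2⁻¹ : ℝ≥0∞) ^ n ≠ ∞ := by
  rw [ENNReal.tsum_geometric, ENNReal.one_sub_inv_two, inv_inv]
  exact ENNReal.ofNat_ne_top

theorem inv_two_pow_pos (n : ℕ) : (0 : ℝ≥0∞) < 2⁻¹ ^ n :=
  ENNReal.pow_pos (ENNReal.inv_pos.2 ENNReal.ofNat_ne_top) n

theorem exists_subset_limsupSet {X : Set Cantor} (hX : X ∈ nullIdeal) :
    ∃ c ∈ clopenNullSeq, X ⊆ limsupSet c := by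
  choose c hc hXc hsum using fun k : ℕ => exists_clopen_cover hX (inv_two_pow_pos k)
  refine ⟨fun n => c n.unpair.1 n.unpair.2, ⟨fun n => hc _ _, limsupSet_mem_nullIdeal ?_⟩, ?_⟩
  · have h : ∑' n : ℕ, cantorMeasure (c n.unpair.1 n.unpair.2) =
        ∑' k, ∑' m, cantorMeasure (c k m) := by
      rw [← ENNReal.tsum_prod]
      exact Nat.pairEquiv.symm.tsum_eq fun p : ℕ × ℕ => cantorMeasure (c p.1 p.2)
    rw [h]
    exact ne_top_of_le_ne_top tsum_inv_two_pow_ne_top (ENNReal.tsum_le_tsum hsum)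
  · intro x hx
    choose m hm using fun k => mem_iUnion.1 (hXc k hx)
    refine infinite_of_injective_forall_mem (f := fun k => Nat.pair k (m k)) ?_ fun k => ?_
    · intro k l h
      exact (Nat.pair_eq_pair.1 h).1
    · simpa using hm k

/-! ### Inclusions between the ideals -/

variable {J : Set (Set ℕ)}

theorem IsIdealOn.limsupSetMod_subset (hJ : IsIdealOn J) (c : ℕ → Set Cantor) :
    limsupSetMod J c ⊆ limsupSet c :=
  fun _ hx hfin => hx (hJ.finite_mem _ hfin)

theorem IsIdealOn.nullMod_subset (hJ : IsIdealOn J) : nullMod J ⊆ nullIdeal := by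
  rintro X ⟨c, hc, hX⟩
  exact measure_mono_null (hX.trans (hJ.limsupSetMod_subset c)) hc.2

theorem HasSeparatingBlocks.nullIdeal_subset (h : HasSeparatingBlocks J) :
    nullIdeal ⊆ nullMod J := by
  intro X hX
  obtain ⟨a, ha, hJ⟩ := h
  obtain ⟨c, hc, hXc⟩ := exists_subset_limsupSet hX
  obtain ⟨r, hr, hr'⟩ := exists_blockIndex ha
  refine ⟨fun k => c (r k), ⟨fun k => hc.1 _, measure_mono_null ?_ hc.2⟩, ?_⟩
  · intro x hx hfin
    obtain ⟨B, hB⟩ := Set.Finite.bddAbove hfin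
    obtain ⟨k, hk, hBk⟩ := Set.Infinite.exists_gt hx (a (B + 1))
    have h1 : r k ≤ B := hB hk
    have h2 := hr' _ _ hBk.le
    omega
  · intro x hx hxJ
    refine hXc hx ((hJ _ hxJ).subset fun j hj i hi => ?_)
    show x ∈ c (r i)
    rw [hr j i hi.1 hi.2]
    exact hj

theorem IsIdealOn.closedNullIdeal_subset (hJ : IsIdealOn J) :
    closedNullIdeal ⊆ nullStarMod J := by
  rintro X ⟨F, hF, hX⟩
  have hG : ∀ n, IsClosed (⋃ i ∈ Finset.range (n + 1), F i) ∧
      cantorMeasure (⋃ i ∈ Finset.range (n + 1), F i) = 0 := fun n =>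
    ⟨isClosed_biUnion_finset fun i _ => (hF i).1,
      (measure_biUnion_null_iff (Finset.countable_toSet _)).2 fun i _ => (hF i).2⟩
  choose c hc hFc hcε using fun n =>
    exists_clopen_superset (hG n).1 (hG n).2 (inv_two_pow_pos n)
  refine ⟨c, ⟨hc, limsupSet_mem_nullIdeal (ne_top_of_le_ne_top tsum_inv_two_pow_ne_top
    (ENNReal.tsum_le_tsum fun n => (hcε n).le))⟩, fun x hx => ?_⟩
  obtain ⟨m, hm⟩ := mem_iUnion.1 (hX hx)
  refine hJ.finite_mem _ ((finite_lt_nat m).subset fun n hn => ?_)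
  by_contra hmn
  exact hn (hFc n (mem_biUnion (Finset.mem_coe.2 (Finset.mem_range_succ_iff.2 (not_lt.1 hmn))) hm))

theorem HasSeparatingBlocks.nullStarMod_subset (h : HasSeparatingBlocks J) :
    nullStarMod J ⊆ closedNullIdeal := by
  rintro X ⟨c, hc, hX⟩
  obtain ⟨a, ha, hJ⟩ := h
  -- The `m`-th closed set consists of the points that meet some `c k` in every block from the
  -- `m`-th on.
  refine ⟨fun m => ⋂ j, ⋂ (_ : m ≤ j), ⋃ k ∈ Finset.Ico (a j) (a (j + 1)), c k, fun m => ⟨?_, ?_⟩,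
    fun x hx => ?_⟩
  · exact isClosed_iInter fun j => isClosed_iInter fun _ =>
      isClosed_biUnion_finset fun k _ => (hc.1 k).1
  · refine measure_mono_null (fun x hx => ?_) hc.2
    refine infinite_of_forall_exists_gt fun B => ?_
    have h1 := mem_iInter₂.1 hx (max m (B + 1)) (le_max_left _ _)
    simp only [mem_iUnion, Finset.mem_Ico] at h1
    obtain ⟨k, hk, hxk⟩ := h1
    refine ⟨k, hxk, ?_⟩
    have h2 := ha.id_le (max m (B + 1))
    have h3 := le_max_right m (B + 1)
    simp only [id] at h2
    omega
  · obtain ⟨B, hB⟩ := (hJ _ (hX hx)).bddAbove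
    refine mem_iUnion.2 ⟨B + 1, mem_iInter₂.2 fun j hj => ?_⟩
    by_contra hcon
    have h1 : j ≤ B := hB fun k hk hxk => hcon
      (mem_biUnion (Finset.mem_coe.2 (Finset.mem_Ico.2 hk)) hxk)
    omega

/-! ### The sequence `zeroBlock` as a counterexample -/

/-- The points that vanish on the `n`-th interval `[n², (n + 1)²)`. -/
def zeroBlock (n : ℕ) : Set Cantor :=
  {x | ∀ i, n * n ≤ i → i < (n + 1) * (n + 1) → x i = false}

theorem zeroBlock_mem_clopenNullSeq : zeroBlock ∈ clopenNullSeq := by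
  refine ⟨fun n => isClopen_of_cylinder (m := (n + 1) * (n + 1)) fun x hx y hy i h1 h2 =>
    (hy i h2).trans (hx i h1 h2), limsupSet_mem_nullIdeal
    (ne_top_of_le_ne_top tsum_inv_two_pow_ne_top (ENNReal.tsum_le_tsum fun n => ?_))⟩
  have h := cantorMeasure_cylinder (Finset.Ico (n * n) (n * n + n)) fun _ => false
  rw [Nat.card_Ico, Nat.add_sub_cancel_left] at h
  rw [← h]
  refine measure_mono fun x hx i hi => ?_
  rw [Finset.mem_Ico] at hi
  exact hx i hi.1 (by nlinarith [hi.2])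

theorem isMeagre_of_mem_closedNullIdeal {X : Set Cantor} (hX : X ∈ closedNullIdeal) :
    IsMeagre X := by
  obtain ⟨F, hF, hXF⟩ := hX
  refine (isMeagre_iUnion fun n => IsNowhereDense.isMeagre ?_).mono hXF
  rw [(hF n).1.isNowhereDense_iff]
  exact Measure.interior_eq_empty_of_null (hF n).2

theorem IsIdealOn.liminfSetMod_zeroBlock_notMem (hJ : IsIdealOn J)
    (h : ¬ HasSeparatingBlocks J) : liminfSetMod J zeroBlock ∉ closedNullIdeal := by
  classical
  intro hE
  have hp : StrictMono fun n : ℕ => n * n := fun m n hmn => Nat.mul_self_lt_mul_self hmn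
  obtain ⟨b, z, hb, hz⟩ := exists_blocks_of_isMeagre (isMeagre_of_mem_closedNullIdeal hE) hp
  simp only [HasSeparatingBlocks, not_exists, not_and, not_forall] at h
  obtain ⟨s, hs, hinf⟩ := h b hb
  -- `Nat.sqrt i` is the index of the square interval containing `i`: copy `z` on intervals indexed
  -- by `s`, vanish on the others.
  refine hz (fun i => if Nat.sqrt i ∈ s then z i else false) (Infinite.mono ?_ hinf)
    (hJ.subset_mem _ s ?_ hs)
  · intro j hj i h1 h2
    have : Nat.sqrt i ∈ s := hj ⟨Nat.le_sqrt.2 h1, Nat.sqrt_lt.2 h2⟩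
    simp [this]
  · intro n hn
    by_contra hns
    refine hn fun i h1 h2 => ?_
    simp [← Nat.eq_sqrt.2 ⟨h1, h2⟩, hns]

/-- One fusion step: fix what decides the early `c n`, append a zero block, then leave `limsupSet c`
by density. `M` works for all prefixes at once. -/
theorem exists_jump {c : ℕ → Set Cantor} (hc : c ∈ clopenNullSeq) (N : ℕ) :
    ∃ q M, N ≤ q ∧ q < M ∧
      (∀ n < N, ∀ x y : Cantor, (∀ i < q * q, y i = x i) → (x ∈ c n ↔ y ∈ c n)) ∧
      ∀ w : Cantor, ∃ y : Cantor, (∀ i < q * q, y i = w i) ∧ y ∈ zeroBlock q ∧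
        ∀ n, y ∈ c n → n < M := by
  choose L hL using fun n => exists_cylinder_of_isClopen (hc.1 n)
  set q := max N ((Finset.range N).sup L) with hq
  have hdense := compl_limsupSet_dense hc.2
  obtain ⟨M, hM⟩ := exists_bound_of_cylinder
    (P := fun M w => ∃ y : Cantor, (∀ i < q * q, y i = w i) ∧ y ∈ zeroBlock q ∧
        ∀ n, y ∈ c n → n < M) (q * q)
    (fun m n x hmn ⟨y, h1, h2, h3⟩ => ⟨y, h1, h2, fun k hk => (h3 k hk).trans_le hmn⟩)
    (fun n x x' hx ⟨y, h1, h2, h3⟩ => ⟨y, fun i hi => (h1 i hi).trans (hx i hi).symm, h2, h3⟩)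
    (fun w => by
      let w' : Cantor := fun i => if i < q * q then w i else false
      obtain ⟨y, hy, hyc⟩ := hdense.inter_open_nonempty _
        (PiNat.isOpen_cylinder (fun _ : ℕ => Bool) w' ((q + 1) * (q + 1)))
        ⟨w', PiNat.self_mem_cylinder w' _⟩
      obtain ⟨B, hB⟩ := (not_infinite.1 hyc).bddAbove
      refine ⟨B + 1, y, fun i hi => ?_, fun i h1 h2 => ?_, fun n hn => Nat.lt_succ_of_le (hB hn)⟩
      · rw [hy i (by nlinarith)]; simp [w', hi]
      · rw [hy i h2]; simp [w', h1.not_gt])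
  refine ⟨q, max M (q + 1), le_max_left _ _, lt_max_of_lt_right q.lt_succ_self, ?_, fun w => ?_⟩
  · intro n hn x y hxy
    refine hL n x y fun i hi => hxy i (hi.trans_le ?_)
    exact (Finset.le_sup (f := L) (Finset.mem_range.2 hn)).trans
      ((le_max_right _ _).trans (Nat.le_mul_self q))
  · obtain ⟨y, h1, h2, h3⟩ := hM w
    exact ⟨y, h1, h2, fun n hn => lt_max_of_lt_left (h3 n hn)⟩

theorem exists_limit {X : ℕ → Cantor} {l : ℕ → ℕ} (hl : StrictMono l)
    (hX : ∀ j, ∀ i < l j, X (j + 1) i = X j i) :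
    ∃ x : Cantor, ∀ j, ∀ i < l j, x i = X j i := by
  have hle : ∀ j k, j ≤ k → ∀ i < l j, X k i = X j i := by
    intro j k hjk i hi
    induction k, hjk using Nat.le_induction with
    | base => rfl
    | succ k hjk ih => rw [hX k i (hi.trans_le (hl.monotone hjk)), ih]
  refine ⟨fun i => X (i + 1) i, fun j i hi => ?_⟩
  rcases le_total j (i + 1) with h | h
  · exact hle j _ h i hi
  · exact (hle _ j h i (Nat.lt_of_succ_le (hl.id_le (i + 1)))).symm

theorem IsIdealOn.limsupSet_zeroBlock_not_subset (hJ : IsIdealOn J)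
    (h : ¬ HasSeparatingBlocks J) {c : ℕ → Set Cantor} (hc : c ∈ clopenNullSeq) :
    ¬ limsupSet zeroBlock ⊆ limsupSetMod J c := by
  classical
  intro hsub
  choose q M hNq hqM hdec Y hYagree hYzero hYc using exists_jump hc
  obtain ⟨x₀, hx₀⟩ := (compl_limsupSet_dense hc.2).nonempty
  obtain ⟨B, hB⟩ := (not_infinite.1 hx₀).bddAbove
  let a : ℕ → ℕ := fun j => M^[j] (B + 1)
  have ha : ∀ j, a (j + 1) = M (a j) := fun j => Function.iterate_succ_apply' _ _ _
  have haq : ∀ j, q (a j) < q (a (j + 1)) := fun j =>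
    (hqM (a j)).trans_le ((ha j).symm ▸ hNq _)
  have hqm : StrictMono fun j => q (a j) := strictMono_nat_of_lt_succ haq
  have ham : StrictMono a := strictMono_nat_of_lt_succ fun j =>
    (hNq (a j)).trans_lt ((hqM (a j)).trans_eq (ha j).symm)
  simp only [HasSeparatingBlocks, not_exists, not_and, not_forall] at h
  obtain ⟨s, hs, hinf⟩ := h a ham
  -- A zero block is added only when the index block lies in `s`, so all new memberships in the `c
  -- n` have `n ∈ s`.
  let X : ℕ → Cantor := fun j => Nat.rec x₀
    (fun j x => if Ico (a j) (a (j + 1)) ⊆ s then Y (a j) x else x) j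
  have hX : ∀ j, X (j + 1) = if Ico (a j) (a (j + 1)) ⊆ s then Y (a j) (X j) else X j :=
    fun j => rfl
  have hXagree : ∀ j, ∀ i < q (a j) * q (a j), X (j + 1) i = X j i := by
    intro j i hi
    rw [hX]
    split_ifs
    · exact hYagree _ _ i hi
    · rfl
  have hXc : ∀ j n, X j ∈ c n → n < B + 1 ∨ n ∈ s := by
    intro j
    induction j with
    | zero => exact fun n hn => Or.inl (Nat.lt_succ_of_le (hB hn))
    | succ j ih =>
      intro n hn
      rcases lt_or_ge n (a j) with hnj | hnj
      · exact ih n ((hdec (a j) n hnj _ _ (hXagree j)).2 hn)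
      · rw [hX] at hn
        split_ifs at hn with hj
        · exact Or.inr (hj ⟨hnj, (ha j).symm ▸ hYc _ _ n hn⟩)
        · exact ih n hn
  obtain ⟨x, hx⟩ := exists_limit
    (fun j k hjk => Nat.mul_self_lt_mul_self (hqm hjk)) hXagree
  have hxzero : x ∈ limsupSet zeroBlock := by
    refine (Set.Infinite.image hqm.injective.injOn hinf).mono ?_
    rintro _ ⟨j, hj, rfl⟩ i h1 h2
    have h3 : i < q (a (j + 1)) * q (a (j + 1)) :=
      h2.trans_le (Nat.mul_self_le_mul_self (haq j))
    have hj' : Ico (a j) (a (j + 1)) ⊆ s := hj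
    rw [hx (j + 1) i h3, hX, if_pos hj']
    exact hYzero _ _ i h1 h2
  refine hsub hxzero (hJ.subset_mem _ _ (fun n hn => ?_)
    (hJ.union_mem _ _ (hJ.finite_mem _ (finite_lt_nat (B + 1))) hs))
  -- Since `n < a (n + 1)`, membership of `x` in `c n` is already decided by `X (n + 1)`.
  exact hXc (n + 1) n ((hdec _ n (ham.id_le (n + 1)) _ _ (hx (n + 1))).2 hn)

end NullModulo

theorem theoremA (J : Set (Set ℕ)) (hJ : NullModulo.IsIdealOn J) :
    List.TFAE
      [NullModulo.HasBaireProperty J,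
       NullModulo.nullMod J = NullModulo.nullIdeal,
       NullModulo.nullStarMod J = NullModulo.closedNullIdeal] := by
  open NullModulo in
  tfae_have 1 → 2 := fun h =>
    hJ.nullMod_subset.antisymm (hJ.hasSeparatingBlocks h).nullIdeal_subset
  tfae_have 1 → 3 := fun h =>
    (hJ.hasSeparatingBlocks h).nullStarMod_subset.antisymm hJ.closedNullIdeal_subset
  tfae_have 2 → 1 := by
    intro h
    by_contra hBP
    obtain ⟨c, hc, hsub⟩ := h.ge zeroBlock_mem_clopenNullSeq.2
    exact hJ.limsupSet_zeroBlock_not_subset (fun hb => hBP hb.hasBaireProperty) hc hsub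
  tfae_have 3 → 1 := by
    intro h
    by_contra hBP
    exact hJ.liminfSetMod_zeroBlock_notMem (fun hb => hBP hb.hasBaireProperty)
      (h.le ⟨zeroBlock, zeroBlock_mem_clopenNullSeq, Subset.rfl⟩)
  tfae_finish
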